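/- Let $\mathbb K$ be a field of characteristic $0$ and let $G$ be a finite loopless graph (multiple edges allowed; in particular, any simple graph) on the vertex set $\{0,1,\dots,n\}$, $n\ge 0$. Let $\Phi_G^T$ be the commutative $\mathbb K$-algebra generated by variables $\phi_e$, one for each edge $e$ of $G$, with the defining relations $\phi_e^2=0$ for every edge $e$, and $\prod_{e\in H}\phi_e=0$ for every set $H$ of edges such that the spanning subgraph $G\setminus H$ (all vertices kept, the edges in $H$ deleted) is not connected. For a vertex $i$ and an edge $e$ put $c_{i,e}=1$ if $e$ joins $i$ to a vertex $j>i$, $c_{i,e}=-1$ if $e$ joins $i$ to a vertex $j<i$, and $c_{i,e}=0$ if $i$ is not an end of $e$. Let $$Y_i^T=\exp\Bigl(\sum_{e\in G}c_{i,e}\phi_e\Bigr)=\prod_{e\in G}(1+c_{i,e}\phi_e)\in\Phi_G^T,\qquad i=0,\dots,n,$$ and let $\mathcal K_G^T\subseteq\Phi_G^T$ be the (unital) subalgebra generated by $Y_0^T,\dots,Y_n^T$. For $I\subseteq\{0,\dots,n\}$ let $D_I$ be the number of edges of $G$ with one end in $I$ and the other end outside $I$. Let $\mathcal I_G^T\subseteq\mathbb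 K[y_0,\dots,y_n]$ be the ideal generated by the polynomials $$\Bigl(\prod_{i\in I}y_i-1\Bigr)^{D_I},\qquad \varnothing\neq I\subsetneq\{0,\dots,n\},$$ together with $\prod_{i=0}^n y_i-1$, and put $\mathcal D_G^T=\mathbb K[y_0,\dots,y_n]/\mathcal I_G^T$. Filter $\mathcal D_G^T$ and $\mathcal K_G^T$ by the degree in their generators: for $k\ge 0$, the $k$-th piece of $\mathcal D_G^T$ (resp. $\mathcal K_G^T$) is the set of values of polynomials of total degree at most $k$ in the classes of $y_0,\dots,y_n$ (resp. in $Y_0^T,\dots,Y_n^T$). Then $\mathcal D_G^T$ and $\mathcal K_G^T$ are isomorphic as filtered algebras: there is an isomorphism of $\mathbb K$-algebras $\mathcal D_G^T\to\mathcal K_G^T$ that maps, for every $k\ge 0$, the $k$-th piece of the filtration of $\mathcal D_G^T$ onto the $k$-th piece of the filtration of $\mathcal K_G^T$. -/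

import Mathlib

open scoped Graph

noncomputable section

namespace SpanningTreeAlgebra

/-! Graphs are Mathlib's multigraphs `Graph α β` on the vertex type `Fin (n + 1)`, that is, on
`{0, …, n}`. The edges of `G` are the elements of the subtype `E(G)`. -/

variable (K : Type*) [Field K] {n : ℕ} {β : Type*} (G : Graph (Fin (n + 1)) β)

open Classical in
/-- The coefficient `c i e`: it is `1` if `e` joins `i` to some `j > i`, it is `-1` if `e` joins
`i` to some `j < i`, and `0` if `i` is not an end of `e`. -/
def coeff (i : Fin (n + 1)) (e : E(G)) : K :=
  if ∃ j, G.IsLink e i j ∧ i < j then 1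
  else if ∃ j, G.IsLink e i j ∧ j < i then -1
  else 0

/-- `D_I`: the number of edges between `I` and its complement. -/
def cutSize (I : Finset (Fin (n + 1))) : ℕ :=
  {e : β | ∃ i ∈ I, ∃ j ∉ I, G.IsLink e i j}.ncard

/-- A set of edges `H` is slim if the spanning subgraph `G \ H`, obtained from `G` by deleting the
edges in `H` and keeping all vertices, is connected. -/
def IsSlim (H : Finset E(G)) : Prop :=
  (G.deleteEdges (Subtype.val '' (H : Set E(G)))).toSimpleGraph.Connected

/-- The relations `φ_e ^ 2 = 0` for all edges `e`, and `∏ e ∈ H, φ_e = 0` for all non-slim `H`. -/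
def phiIdeal : Ideal (MvPolynomial E(G) K) :=
  Ideal.span
    ({p | ∃ e : E(G), p = MvPolynomial.X e ^ 2} ∪
      {p | ∃ H : Finset E(G), ¬ IsSlim G H ∧ p = ∏ e ∈ H, MvPolynomial.X e})

/-- The algebra `Φ_G^T`. -/
abbrev PhiT : Type _ := MvPolynomial E(G) K ⧸ phiIdeal K G

/-- The generator `φ_e` of `Φ_G^T`. -/
def phi (e : E(G)) : PhiT K G := Ideal.Quotient.mk (phiIdeal K G) (MvPolynomial.X e)

/-- `X_i^T = ∑ e, c i e • φ_e`. -/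
def xT [Fintype E(G)] (i : Fin (n + 1)) : PhiT K G := ∑ e : E(G), coeff K G i e • phi K G e

/-- `Y_i^T = ∏ e, (1 + c i e • φ_e)`, which is `exp (X_i^T)` by `exp_xT` below. -/
def yT [Fintype E(G)] (i : Fin (n + 1)) : PhiT K G := ∏ e : E(G), (1 + coeff K G i e • phi K G e)

theorem phi_sq (e : E(G)) : phi K G e ^ 2 = 0 := by
  rw [phi, ← map_pow, Ideal.Quotient.eq_zero_iff_mem]
  exact Ideal.subset_span (Or.inl ⟨e, rfl⟩)

/-- The element `Y_i^T` is the exponential of the nilpotent element `X_i^T`. -/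
theorem exp_xT [CharZero K] [Fintype E(G)] (i : Fin (n + 1)) :
    IsNilpotent (xT K G i) ∧ IsNilpotent.exp (xT K G i) = yT K G i := by
  classical
  have hsq (e : E(G)) : (coeff K G i e • phi K G e) ^ 2 = 0 := by
    rw [smul_pow, phi_sq, smul_zero]
  have key (s : Finset E(G)) : IsNilpotent (∑ e ∈ s, coeff K G i e • phi K G e) ∧
      IsNilpotent.exp (∑ e ∈ s, coeff K G i e • phi K G e) =
        ∏ e ∈ s, (1 + coeff K G i e • phi K G e) := by
    induction s using Finset.induction_on with
    | empty => simp
    | insert a s ha ih =>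
      have hn : IsNilpotent (coeff K G i a • phi K G a) := ⟨2, hsq a⟩
      rw [Finset.sum_insert ha, Finset.prod_insert ha]
      refine ⟨(Commute.all _ _).isNilpotent_add hn ih.1, ?_⟩
      rw [IsNilpotent.exp_add_of_commute (Commute.all _ _) hn ih.1, ih.2,
        IsNilpotent.exp_eq_sum (hsq a)]
      simp [Finset.sum_range_succ]
  exact key Finset.univ

/-- The algebra `K_G^T`: the subalgebra of `Φ_G^T` generated by `Y_0^T, …, Y_n^T`. -/
def algK [Fintype E(G)] : Subalgebra K (PhiT K G) := Algebra.adjoin K (Set.range (yT K G))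

/-- The generator `Y_i^T` as an element of `K_G^T`. -/
def genK [Fintype E(G)] (i : Fin (n + 1)) : algK K G :=
  ⟨yT K G i, Algebra.subset_adjoin (Set.mem_range_self i)⟩

/-- The ideal `I_G^T`, generated by `(∏ i ∈ I, y_i - 1) ^ D_I` for all nonempty proper subsets `I`
of `{0, …, n}`, together with `∏ i, y_i - 1`. -/
def idealD : Ideal (MvPolynomial (Fin (n + 1)) K) :=
  Ideal.span
    ({p | ∃ I : Finset (Fin (n + 1)), I.Nonempty ∧ I ≠ Finset.univ ∧
        p = (∏ i ∈ I, MvPolynomial.X i - 1) ^ cutSize G I} ∪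
      {∏ i : Fin (n + 1), MvPolynomial.X i - 1})

/-- The algebra `D_G^T = K[y_0, …, y_n] / I_G^T`. -/
abbrev AlgD : Type _ := MvPolynomial (Fin (n + 1)) K ⧸ idealD K G

/-- The class of `y_i` in `D_G^T`. -/
def genD (i : Fin (n + 1)) : AlgD K G := Ideal.Quotient.mk (idealD K G) (MvPolynomial.X i)

/-- The increasing filtration of an algebra `A` given by a family of generators `a`: the `k`-th
piece consists of all values at `a` of polynomials of total degree at most `k`, that is, it is the
span of all products of at most `k` generators. -/
def filtration {ι A : Type*} [CommRing A] [Algebra K A] (a : ι → A) (k : ℕ) : Submodule K A :=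
  (MvPolynomial.restrictTotalDegree ι K k).map (MvPolynomial.aeval a).toLinearMap

end SpanningTreeAlgebra

end

open scoped Graph
open MvPolynomial

noncomputable section

set_option linter.unusedSectionVars false

namespace SpanningTreeAlgebra

/-! ### Edge derivations, cut sums and the substitution into edge variables. -/

section Core

variable {K V E : Type*} [Field K] [Fintype V] [DecidableEq V] [Fintype E] [DecidableEq E]

/-! The isomorphism sends `y_i` to `Y_i`, so everything reduces to `ker_aeval_yT`: the relations
among the `Y_i` are exactly `idealD`. Write `Y_i = exp X_i` with `X_i` linear in the `φ_e`. For
nilpotent `x`, `exp x - 1` is a unit times `x`, so each relation on a cut product of the `Y_i` is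
equivalent to one on a cut sum of the `X_i`. The cut sum over `I` involves only the edges crossing
`I`, and its power `D_I` is a multiple of the product of these edges, which is zero; this gives the
easy inclusion.

For the other inclusion, the relations among the `X_i` must be spanned by multiples of powers of cut
sums and of the sum of all variables. If `f(X) = 0`, the coefficients of `f` at all slim squarefree
edge monomials vanish, and `mem_cutSpan_of_slimVanish` finishes by deletion and contraction. The set
`F` holds contracted edges and `A` the remaining ones; `∂/∂φ_e` corresponds to `D_e = ∂/∂x_{s e} -
∂/∂x_{t e}` on vertex polynomials. Deleting `e` places `D_e f` in the smaller span; an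
antiderivative `g` in the larger span is subtracted; `f - g` is killed by `D_e`, which is the
contracted case.

The exponential carries this back: in `AlgD` each `y_i` has a nilpotent logarithm, and truncated
exponentials turn a relation among the `Y_i` into one among the `X_i`. -/

/-- The edge `e`, directed from `s e` to `t e`, joins `I` to its complement. -/
def Crosses (s t : E → V) (I : Finset V) (e : E) : Prop := ¬ (s e ∈ I ↔ t e ∈ I)

instance (s t : E → V) (I : Finset V) : DecidablePred (Crosses s t I) :=
  fun _ => inferInstanceAs (Decidable (¬ _))

/-- The edges in `B` connect all the vertices: every proper cut is crossed by `B`. -/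
def Connects (s t : E → V) (B : Finset E) : Prop :=
  ∀ I : Finset V, I.Nonempty → I ≠ Finset.univ → ∃ e ∈ B, Crosses s t I e

/-- The derivation `∂ / ∂ x_{s e} - ∂ / ∂ x_{t e}` of the polynomial ring on the vertices. -/
def edgeDeriv (K : Type*) [Field K] (s t : E → V) (e : E) :
    Derivation K (MvPolynomial V K) (MvPolynomial V K) :=
  pderiv (s e) - pderiv (t e)

/-- The signed incidence number of `i` and `e`. -/
def incidence (K : Type*) [Field K] (s t : E → V) (i : V) (e : E) : K :=
  (if s e = i then 1 else 0) - (if t e = i then 1 else 0)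

/-- The substitution `x_i ↦ ∑ e, ± φ_e` into the polynomial ring on the edges. -/
def toEdges (K : Type*) [Field K] (s t : E → V) : MvPolynomial V K →ₐ[K] MvPolynomial E K :=
  aeval fun i => ∑ e, incidence K s t i e • X e

/-- The linear form `∑ i ∈ I, x_i`. -/
def vertexSum (K : Type*) [Field K] (I : Finset V) : MvPolynomial V K := ∑ i ∈ I, X i

/-- The polynomials killed by the derivations of the edges in `F`. -/
def constants (K : Type*) [Field K] (s t : E → V) (F : Finset E) :
    Subalgebra K (MvPolynomial V K) where
  carrier := {f | ∀ e ∈ F, edgeDeriv K s t e f = 0}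
  mul_mem' ha hb e he := by simp [Derivation.leibniz, ha e he, hb e he]
  add_mem' ha hb e he := by simp [ha e he, hb e he]
  algebraMap_mem' r e _ := (edgeDeriv K s t e).map_algebraMap r

/-- The span of the multiples, by constants of `F`, of the powers of cut sums and of the sum of all
variables. -/
def cutSpan (K : Type*) [Field K] (s t : E → V) (F A : Finset E) :
    Submodule K (MvPolynomial V K) :=
  Submodule.span K
    ({p | ∃ I : Finset V, I.Nonempty ∧ I ≠ Finset.univ ∧ (∀ e ∈ F, ¬ Crosses s t I e) ∧
        ∃ h ∈ constants K s t F, p = vertexSum K I ^ (A.filter (Crosses s t I)).card * h} ∪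
      {p | ∃ h ∈ constants K s t F, p = vertexSum K Finset.univ * h})

/-- The exponent of the squarefree monomial of `H`. -/
def indicatorExp (H : Finset E) : E →₀ ℕ := ∑ e ∈ H, Finsupp.single e 1

/-- The coefficients of `f`, in the edge variables, at the squarefree monomials of all the sets
`H ⊆ A` whose deletion leaves a connected graph, vanish. -/
def SlimVanish (s t : E → V) (F A : Finset E) (f : MvPolynomial V K) : Prop :=
  ∀ H ⊆ A, Connects s t (A \ H ∪ F) → MvPolynomial.coeff (indicatorExp H) (toEdges K s t f) = 0

theorem pderiv_comm' (i j : V) (f : MvPolynomial V K) :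
    pderiv i (pderiv j f) = pderiv j (pderiv i f) := by
  ext m
  simp only [coeff_pderiv]
  rcases eq_or_ne i j with rfl | h
  · rfl
  · simp [add_right_comm m, h, h.symm]
    ring

theorem edgeDeriv_comm (s t : E → V) (e e' : E) (f : MvPolynomial V K) :
    edgeDeriv K s t e (edgeDeriv K s t e' f) = edgeDeriv K s t e' (edgeDeriv K s t e f) := by
  simp only [edgeDeriv, Derivation.sub_apply, map_sub, pderiv_comm' (s e), pderiv_comm' (t e)]
  ring

theorem edgeDeriv_mem_constants {s t : E → V} {F : Finset E} (e : E) {f : MvPolynomial V K}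
    (hf : f ∈ constants K s t F) : edgeDeriv K s t e f ∈ constants K s t F := fun e' he' => by
  rw [edgeDeriv_comm, hf e' he', map_zero]

theorem pderiv_vertexSum (i : V) (I : Finset V) :
    pderiv i (vertexSum K I) = if i ∈ I then 1 else 0 := by
  simp [vertexSum, pderiv_X, Pi.single_apply, eq_comm]

theorem edgeDeriv_vertexSum (s t : E → V) (e : E) (I : Finset V) :
    edgeDeriv K s t e (vertexSum K I) =
      C ((if s e ∈ I then 1 else 0) - (if t e ∈ I then 1 else 0)) := by
  simp only [edgeDeriv, Derivation.sub_apply, pderiv_vertexSum]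
  split_ifs <;> simp

theorem edgeDeriv_vertexSum_of_not_crosses {s t : E → V} {e : E} {I : Finset V}
    (h : ¬ Crosses s t I e) : edgeDeriv K s t e (vertexSum K I) = 0 := by
  rw [edgeDeriv_vertexSum]
  unfold Crosses at h
  by_cases h1 : s e ∈ I <;> by_cases h2 : t e ∈ I <;> simp_all

theorem edgeDeriv_vertexSum_of_crosses {s t : E → V} {e : E} {I : Finset V}
    (h : Crosses s t I e) : ∃ c : K, c ≠ 0 ∧ edgeDeriv K s t e (vertexSum K I) = C c := by
  refine ⟨_, ?_, edgeDeriv_vertexSum s t e I⟩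
  unfold Crosses at h
  by_cases h1 : s e ∈ I <;> by_cases h2 : t e ∈ I <;> simp_all

theorem vertexSum_mem_constants {s t : E → V} {F : Finset E} {I : Finset V}
    (h : ∀ e ∈ F, ¬ Crosses s t I e) : vertexSum K I ∈ constants K s t F :=
  fun e he => edgeDeriv_vertexSum_of_not_crosses (h e he)

/-! ### Antidifferentiation of polynomials. -/

/-- All the monomials of `f` have degree less than `n`. -/
def DegreeLT (n : ℕ) (f : MvPolynomial V K) : Prop :=
  ∀ m : V →₀ ℕ, n ≤ m.degree → MvPolynomial.coeff m f = 0

theorem exists_degreeLT (f : MvPolynomial V K) : ∃ n, DegreeLT n f := by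
  refine ⟨f.totalDegree + 1, fun m hm => coeff_eq_zero_of_totalDegree_lt ?_⟩
  exact Nat.lt_of_succ_le hm

theorem DegreeLT.eq_zero {f : MvPolynomial V K} (h : DegreeLT 0 f) : f = 0 := by
  ext m
  simpa using h m (Nat.zero_le _)

theorem DegreeLT.pderiv {f : MvPolynomial V K} {n : ℕ} (h : DegreeLT (n + 1) f) (i : V) :
    DegreeLT n (MvPolynomial.pderiv i f) := fun m hm => by
  rw [coeff_pderiv, h, zero_mul]
  simpa using hm

theorem DegreeLT.edgeDeriv {f : MvPolynomial V K} {n : ℕ} (h : DegreeLT (n + 1) f)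
    (s t : E → V) (e : E) : DegreeLT n (edgeDeriv K s t e f) := fun m hm => by
  simp [SpanningTreeAlgebra.edgeDeriv, h.pderiv (s e) m hm, h.pderiv (t e) m hm]

/-- Antidifferentiation along a derivation that lowers degrees and has a slice `u`. -/
theorem exists_antiderivative [CharZero K] {S : Subalgebra K (MvPolynomial V K)}
    {D : Derivation K (MvPolynomial V K) (MvPolynomial V K)} (hS : ∀ f ∈ S, D f ∈ S)
    (hD : ∀ f n, DegreeLT (n + 1) f → DegreeLT n (D f)) {u : MvPolynomial V K} (hu : u ∈ S) {c : K}
    (hc : c ≠ 0) (hDu : D u = C c) {f : MvPolynomial V K} (hf : f ∈ S) (m : ℕ) :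
    ∃ g ∈ S, D (u ^ (m + 1) * g) = u ^ m * f := by
  obtain ⟨n, hn⟩ := exists_degreeLT f
  induction n generalizing f m with
  | zero => exact ⟨0, S.zero_mem, by simp [hn.eq_zero]⟩
  | succ n ih =>
    -- Integration by parts: `D (u ^ (m + 1) * f)` is `(m + 1) * c * u ^ m * f` plus `u ^ (m + 1) *
    -- D f`, and the last term has an antiderivative by induction on the degree bound.
    obtain ⟨g, hg, hDg⟩ := ih (hS f hf) (m + 1) (hD f n hn)
    have hm : ((m : K) + 1) * c ≠ 0 := mul_ne_zero (by exact_mod_cast m.succ_ne_zero) hc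
    refine ⟨C (((m : K) + 1) * c)⁻¹ * (f - u * g),
      S.mul_mem (S.algebraMap_mem _) (S.sub_mem hf (S.mul_mem hu hg)), ?_⟩
    have h1 : u ^ (m + 1) * (C (((m : K) + 1) * c)⁻¹ * (f - u * g)) =
        (((m : K) + 1) * c)⁻¹ • (u ^ (m + 1) * f - u ^ (m + 1 + 1) * g) := by
      rw [smul_eq_C_mul]; ring
    rw [h1, D.map_smul, map_sub, hDg, Derivation.leibniz, Derivation.leibniz_pow, hDu,
      smul_eq_C_mul]
    have h2 : C (((m : K) + 1) * c)⁻¹ * (C ((m : K) + 1) * C c) = (1 : MvPolynomial V K) := by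
      rw [← C_mul, ← C_mul, inv_mul_cancel₀ hm, C_1]
    have h3 : (C ((m : K) + 1) : MvPolynomial V K) = (m : MvPolynomial V K) + 1 := by simp
    rw [h3] at h2
    simp only [nsmul_eq_mul, smul_eq_mul, Nat.add_sub_cancel, Nat.cast_add, Nat.cast_one]
    linear_combination (u ^ m * f) * h2

theorem eq_C_of_pderiv_eq_zero [CharZero K] {f : MvPolynomial V K} (h : ∀ i, pderiv i f = 0) :
    f = C (constantCoeff f) := by
  ext m
  rw [coeff_C]
  split_ifs with hm
  · rw [← hm]; rfl
  · obtain ⟨i, hi⟩ : ∃ i, m i ≠ 0 := by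
      by_contra! h0
      exact hm (Finsupp.ext fun i => (h0 i).symm)
    have := congrArg (MvPolynomial.coeff (m - Finsupp.single i 1)) (h i)
    have hle : Finsupp.single i 1 ≤ m := by simpa using Nat.one_le_iff_ne_zero.2 hi
    rw [coeff_pderiv, tsub_add_cancel_of_le hle, coeff_zero] at this
    refine (mul_eq_zero.1 this).resolve_right ?_
    exact Nat.cast_add_one_ne_zero _

/-! ### Constants of contracted edges and the span of cut powers. -/

/-- On constants of `F`, the partial derivatives at vertices joined by `F` agree. -/
theorem pderiv_eq_of_forall_not_crosses {s t : E → V} {F : Finset E} {f : MvPolynomial V K}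
    (hf : f ∈ constants K s t F) {i j : V}
    (h : ∀ I : Finset V, i ∈ I → (∀ e ∈ F, ¬ Crosses s t I e) → j ∈ I) :
    pderiv j f = pderiv i f := by
  classical
  -- The vertices whose partial derivative equals that at `i` form a set that no edge of `F`
  -- crosses.
  have := h (Finset.univ.filter fun k => pderiv k f = pderiv i f) (by simp) fun e he => by
    have h1 : pderiv (s e) f = pderiv (t e) f := sub_eq_zero.1 (hf e he)
    simp [Crosses, h1]
  simpa using this

/-- When `F` connects everything, all partial derivatives of a constant agree. Antidifferentiating
one of them gives a multiple of the sum of all variables that differs from `f` by a scalar, which is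
zero by `h0`. -/
theorem mem_cutSpan_of_connects [CharZero K] [Nonempty V] {s t : E → V} {F A : Finset E}
    (hF : Connects s t F) {f : MvPolynomial V K} (hf : f ∈ constants K s t F)
    (h0 : constantCoeff f = 0) : f ∈ cutSpan K s t F A := by
  obtain ⟨i⟩ := ‹Nonempty V›
  have huniv (I : Finset V) (hi : i ∈ I) (hI : ∀ e ∈ F, ¬ Crosses s t I e) : I = Finset.univ := by
    by_contra hne
    obtain ⟨e, he, hc⟩ := hF I ⟨i, hi⟩ hne
    exact hI e he hc
  have hconst {g : MvPolynomial V K} (hg : g ∈ constants K s t F) (j : V) :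
      pderiv j g = pderiv i g :=
    pderiv_eq_of_forall_not_crosses hg fun I hi hI => by simp [huniv I hi hI]
  have hs : vertexSum K Finset.univ ∈ constants K s t F :=
    vertexSum_mem_constants fun e _ => by simp [Crosses]
  have hS (g) (hg : g ∈ constants K s t F) : pderiv i g ∈ constants K s t F := fun e he => by
    have := hg e he
    simp only [edgeDeriv, Derivation.sub_apply] at this ⊢
    rw [pderiv_comm' (s e), pderiv_comm' (t e), ← map_sub, this, map_zero]
  obtain ⟨g, hg, hfg⟩ := exists_antiderivative (D := pderiv i) hS (fun f n h => h.pderiv i) hs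
    one_ne_zero (by simp [pderiv_vertexSum]) (hS f hf) 0
  have hsg : vertexSum K Finset.univ * g ∈ constants K s t F := Subalgebra.mul_mem _ hs hg
  have heq : f = vertexSum K Finset.univ * g := by
    rw [← sub_eq_zero, eq_C_of_pderiv_eq_zero (f := f - vertexSum K Finset.univ * g)]
    · simp [h0, vertexSum]
    · intro j
      rw [map_sub, hconst hf, hconst hsg, ← sub_eq_zero.2 hfg.symm]
      simp
  rw [heq]
  exact Submodule.subset_span (Or.inr ⟨g, hg, rfl⟩)

/-- Cuts admitted on the left are not crossed by `e`, so moving `e` from `F` to `A` leaves their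
exponents unchanged. -/
theorem cutSpan_insert_le {s t : E → V} {F A : Finset E} {e : E} :
    cutSpan K s t (insert e F) A ≤ cutSpan K s t F (insert e A) := by
  have hle : constants K s t (insert e F) ≤ constants K s t F :=
    fun f hf e' he' => hf e' (Finset.mem_insert_of_mem he')
  refine Submodule.span_mono (Set.union_subset_union ?_ ?_)
  · rintro _ ⟨I, h1, h2, h3, h, hh, rfl⟩
    refine ⟨I, h1, h2, fun e' he' => h3 e' (Finset.mem_insert_of_mem he'), h, hle hh, ?_⟩
    rw [Finset.filter_insert, if_neg (h3 e (Finset.mem_insert_self _ _))]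
  · rintro _ ⟨h, hh, rfl⟩
    exact ⟨h, hle hh, rfl⟩

theorem cutSpan_le_constants {s t : E → V} {F A : Finset E} :
    cutSpan K s t F A ≤ (constants K s t F).toSubmodule := by
  refine Submodule.span_le.2 (Set.union_subset ?_ ?_)
  · rintro _ ⟨I, -, -, h3, h, hh, rfl⟩
    exact Subalgebra.mul_mem _ (Subalgebra.pow_mem _ (vertexSum_mem_constants h3) _) hh
  · rintro _ ⟨h, hh, rfl⟩
    exact Subalgebra.mul_mem _ (vertexSum_mem_constants fun e _ => by simp [Crosses]) hh

/-- Antidifferentiation along an edge that crosses a cut closed under `F`. -/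
theorem exists_mem_cutSpan_edgeDeriv_eq [CharZero K] {s t : E → V} {F A : Finset E} {e : E}
    (he : e ∉ A) {J : Finset V} (hJ : ∀ e ∈ F, ¬ Crosses s t J e) (heJ : Crosses s t J e)
    {f : MvPolynomial V K} (hf : f ∈ cutSpan K s t F A) :
    ∃ g ∈ cutSpan K s t F (insert e A), edgeDeriv K s t e g = f := by
  have key {u h : MvPolynomial V K} (hu : edgeDeriv K s t e u = 0) (hh : h ∈ constants K s t F) :
      ∃ g ∈ constants K s t F, edgeDeriv K s t e (u * g) = u * h := by
    obtain ⟨c, hc, hDc⟩ := edgeDeriv_vertexSum_of_crosses (K := K) heJ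
    obtain ⟨g, hg, hDg⟩ := exists_antiderivative (D := edgeDeriv K s t e)
      (fun f hf => edgeDeriv_mem_constants e hf) (fun f n h => h.edgeDeriv s t e)
      (vertexSum_mem_constants hJ) hc hDc hh 0
    refine ⟨vertexSum K J ^ (0 + 1) * g,
      Subalgebra.mul_mem _ (Subalgebra.pow_mem _ (vertexSum_mem_constants hJ) _) hg, ?_⟩
    rw [Derivation.leibniz, hDg, hu]
    simp
  suffices h : cutSpan K s t F A ≤
      (cutSpan K s t F (insert e A)).map (edgeDeriv K s t e).toLinearMap by
    simpa using h hf
  refine Submodule.span_le.2 (Set.union_subset ?_ ?_)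
  · rintro _ ⟨I, h1, h2, h3, h, hh, rfl⟩
    -- If `e` crosses `I`, the sum over `I` is itself a slice, and antidifferentiation raises its
    -- power by one, matching the extra crossing edge in `insert e A`. Otherwise the power is killed
    -- by `D_e`, and only `h` is antidifferentiated, with the slice of `J`.
    by_cases hc : Crosses s t I e
    · obtain ⟨c, hc0, hDc⟩ := edgeDeriv_vertexSum_of_crosses (K := K) hc
      obtain ⟨g, hg, hDg⟩ := exists_antiderivative (D := edgeDeriv K s t e)
        (fun f hf => edgeDeriv_mem_constants e hf) (fun f n h => h.edgeDeriv s t e)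
        (vertexSum_mem_constants h3) hc0 hDc hh (A.filter (Crosses s t I)).card
      refine ⟨_, Submodule.subset_span (Or.inl ⟨I, h1, h2, h3, g, hg, rfl⟩), ?_⟩
      rw [Finset.filter_insert, if_pos hc, Finset.card_insert_of_notMem (by simp [he])]
      exact hDg
    · obtain ⟨g, hg, hDg⟩ := key (u := vertexSum K I ^ (A.filter (Crosses s t I)).card)
        (by simp [Derivation.leibniz_pow, edgeDeriv_vertexSum_of_not_crosses hc]) hh
      refine ⟨_, Submodule.subset_span (Or.inl ⟨I, h1, h2, h3, g, hg, rfl⟩), ?_⟩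
      rw [Finset.filter_insert, if_neg hc]
      exact hDg
  · rintro _ ⟨h, hh, rfl⟩
    obtain ⟨g, hg, hDg⟩ := key (u := vertexSum K Finset.univ)
      (edgeDeriv_vertexSum_of_not_crosses (by simp [Crosses])) hh
    exact ⟨_, Submodule.subset_span (Or.inr ⟨g, hg, rfl⟩), hDg⟩

/-! ### Coefficients at squarefree edge monomials. -/

theorem indicatorExp_insert {H : Finset E} {e : E} (he : e ∉ H) :
    indicatorExp (insert e H) = indicatorExp H + Finsupp.single e 1 := by
  rw [indicatorExp, Finset.sum_insert he, add_comm]; rfl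

theorem indicatorExp_apply (H : Finset E) (e : E) :
    indicatorExp H e = if e ∈ H then 1 else 0 := by
  simp [indicatorExp, Finsupp.finsetSum_apply, Finsupp.single_apply]

theorem coeff_indicatorExp_insert {H : Finset E} {e : E} (he : e ∉ H) (p : MvPolynomial E K) :
    MvPolynomial.coeff (indicatorExp (insert e H)) p =
      MvPolynomial.coeff (indicatorExp H) (pderiv e p) := by
  rw [coeff_pderiv, indicatorExp_insert he, indicatorExp_apply, if_neg he]
  simp

/-- Chain rule: the variable of `e` enters with coefficient `+1` at `s e` and `-1` at `t e`. -/
theorem pderiv_toEdges (s t : E → V) (e : E) (f : MvPolynomial V K) :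
    pderiv e (toEdges K s t f) = toEdges K s t (edgeDeriv K s t e f) := by
  induction f using MvPolynomial.induction_on with
  | C a => simp [toEdges, edgeDeriv]
  | add p q hp hq => simp [hp, hq]
  | mul_X p i hp =>
    have h1 : pderiv e (toEdges K s t (X i)) = toEdges K s t (edgeDeriv K s t e (X i)) := by
      simp only [toEdges, aeval_X, map_sum, Derivation.map_smul, edgeDeriv, Derivation.sub_apply,
        pderiv_X, Pi.single_apply, incidence, eq_comm (a := i)]
      simp only [smul_ite, smul_zero, Finset.sum_ite_eq', Finset.mem_univ,
        if_true, map_sub]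
      split_ifs <;> simp
    rw [map_mul, Derivation.leibniz, hp, h1, Derivation.leibniz]
    simp

theorem constantCoeff_toEdges (s t : E → V) (f : MvPolynomial V K) :
    constantCoeff (toEdges K s t f) = constantCoeff f := by
  induction f using MvPolynomial.induction_on with
  | C a => simp [toEdges]
  | add p q hp hq => simp [hp, hq]
  | mul_X p i hp => simp [toEdges, smul_eq_C_mul]

/-- Extracting the coefficient amounts to differentiating once along each edge of `H`. Only a
crossing edge can lower the power of the cut sum, and by at most one, so a factor of zero constant
term survives. -/
theorem coeff_indicatorExp_toEdges_pow_mul {s t : E → V} (I : Finset V) (m : ℕ) (H : Finset E)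
    (hm : (H.filter (Crosses s t I)).card < m) (h : MvPolynomial V K) :
    MvPolynomial.coeff (indicatorExp H) (toEdges K s t (vertexSum K I ^ m * h)) = 0 := by
  induction H using Finset.induction_on generalizing m h with
  | empty =>
    have h0 : constantCoeff (toEdges K s t (vertexSum K I)) = 0 := by
      simp [constantCoeff_toEdges, vertexSum]
    have : constantCoeff (toEdges K s t (vertexSum K I ^ m * h)) = 0 := by
      rw [map_mul, map_mul, map_pow, map_pow, h0, zero_pow (by simp at hm; omega), zero_mul]
    simpa [indicatorExp, constantCoeff_eq] using this
  | insert e H he ih =>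
    rw [coeff_indicatorExp_insert he, pderiv_toEdges, Derivation.leibniz, Derivation.leibniz_pow,
      map_add, coeff_add]
    rw [Finset.filter_insert] at hm
    have hle : (H.filter (Crosses s t I)).card < m :=
      lt_of_le_of_lt (by split_ifs <;> simp [Finset.card_le_card, Finset.subset_insert]) hm
    rw [smul_eq_mul, ih m hle, zero_add]
    by_cases hc : Crosses s t I e
    · rw [if_pos hc, Finset.card_insert_of_notMem (by simp [he])] at hm
      have : h • m • vertexSum K I ^ (m - 1) • edgeDeriv K s t e (vertexSum K I) =
          vertexSum K I ^ (m - 1) * (m * h * edgeDeriv K s t e (vertexSum K I)) := by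
        simp only [smul_eq_mul, nsmul_eq_mul]; ring
      rw [this]
      exact ih _ (by omega) _
    · simp [edgeDeriv_vertexSum_of_not_crosses hc]

theorem toEdges_vertexSum_univ (s t : E → V) :
    toEdges K s t (vertexSum K Finset.univ) = 0 := by
  simp only [vertexSum, toEdges, map_sum, aeval_X]
  rw [Finset.sum_comm]
  simp [← Finset.sum_smul, incidence]

theorem slimVanish_of_mem_cutSpan {s t : E → V} {F A : Finset E} {f : MvPolynomial V K}
    (hf : f ∈ cutSpan K s t F A) : SlimVanish s t F A f := by
  intro H hH hconn
  suffices h : cutSpan K s t F A ≤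
      LinearMap.ker ((lcoeff K (indicatorExp H)).comp (toEdges K s t).toLinearMap) from h hf
  refine Submodule.span_le.2 (Set.union_subset ?_ ?_)
  · rintro _ ⟨I, h1, h2, h3, h, hh, rfl⟩
    refine coeff_indicatorExp_toEdges_pow_mul I _ H ?_ h
    -- No edge of `F` crosses `I`, so some edge of `A \ H` does; hence strictly fewer edges of `H`
    -- than of `A` cross `I`.
    obtain ⟨e, he, hc⟩ := hconn I h1 h2
    rcases Finset.mem_union.1 he with he | he
    · rw [Finset.mem_sdiff] at he
      refine Finset.card_lt_card (Finset.ssubset_iff_subset_ne.2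
        ⟨Finset.filter_subset_filter _ hH, fun heq => he.2 ?_⟩)
      have : e ∈ A.filter (Crosses s t I) := Finset.mem_filter.2 ⟨he.1, hc⟩
      rw [← heq] at this
      exact (Finset.mem_filter.1 this).1
    · exact absurd hc (h3 e he)
  · rintro _ ⟨h, hh, rfl⟩
    simp [toEdges_vertexSum_univ]

/-- Deletion: the coefficient of `D_e f` at `H` is that of `f` at `insert e H`. -/
theorem SlimVanish.edgeDeriv {s t : E → V} {F A : Finset E} {e : E} (he : e ∉ A)
    {f : MvPolynomial V K} (hf : SlimVanish s t F (insert e A) f) :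
    SlimVanish s t F A (edgeDeriv K s t e f) := fun H hH hconn => by
  have heH : e ∉ H := fun h => he (hH h)
  rw [← pderiv_toEdges, ← coeff_indicatorExp_insert heH]
  refine hf _ (Finset.insert_subset_insert e hH) ?_
  rwa [Finset.insert_sdiff_insert, Finset.sdiff_insert_of_notMem he]

/-- Contraction: for `H ⊆ A` the edge `e` is kept, whether it is counted in `A` or in `F`. -/
theorem SlimVanish.insert {s t : E → V} {F A : Finset E} {e : E} (he : e ∉ A)
    {f : MvPolynomial V K} (hf : SlimVanish s t F (Insert.insert e A) f) :
    SlimVanish s t (Insert.insert e F) A f := fun H hH hconn => by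
  refine hf _ (hH.trans (Finset.subset_insert _ _)) ?_
  rwa [Finset.insert_sdiff_of_notMem _ fun h => he (hH h), Finset.insert_union,
    ← Finset.union_insert]

/-- Deletion and contraction: the polynomials whose coefficients at all slim sets vanish are spanned
by multiples of powers of cut sums and of the sum of all variables. -/
theorem mem_cutSpan_of_slimVanish [CharZero K] [Nonempty V] {s t : E → V} (A : Finset E)
    (F : Finset E) {f : MvPolynomial V K} (hf : f ∈ constants K s t F)
    (hN : SlimVanish s t F A f) : f ∈ cutSpan K s t F A := by
  induction A using Finset.induction_on generalizing F f with
  | empty =>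
    by_cases hF : Connects s t F
    · refine mem_cutSpan_of_connects hF hf ?_
      have := hN ∅ (Finset.Subset.refl _) (by simpa using hF)
      rw [← constantCoeff_toEdges s t]
      simpa [indicatorExp, constantCoeff_eq] using this
    · unfold Connects at hF
      push Not at hF
      obtain ⟨I, h1, h2, h3⟩ := hF
      -- With no edges left the exponent of this cut is `0`, so every constant lies in the span.
      exact Submodule.subset_span (Or.inl ⟨I, h1, h2, h3, f, hf, by simp⟩)
  | insert e A he ih =>
    obtain ⟨g, hg, hDg⟩ : ∃ g ∈ cutSpan K s t F (insert e A),
        edgeDeriv K s t e g = edgeDeriv K s t e f := by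
      by_cases hJ : ∃ J : Finset V, (∀ e ∈ F, ¬ Crosses s t J e) ∧ Crosses s t J e
      · obtain ⟨J, hJ, heJ⟩ := hJ
        exact exists_mem_cutSpan_edgeDeriv_eq he hJ heJ
          (ih F (edgeDeriv_mem_constants e hf) (hN.edgeDeriv he))
      · push Not at hJ
        -- Here `F` already joins the ends of `e`, so `D_e f = 0`.
        refine ⟨0, Submodule.zero_mem _, ?_⟩
        rw [map_zero, eq_comm]
        refine sub_eq_zero.2 (pderiv_eq_of_forall_not_crosses hf fun I hi hI => ?_)
        have := hJ I hI
        unfold Crosses at this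
        tauto
    have hgc := cutSpan_le_constants hg
    have hgN := slimVanish_of_mem_cutSpan hg
    -- The difference is killed by `D_e` as well, so the contracted case applies.
    have hsub : f - g ∈ cutSpan K s t (insert e F) A := by
      refine ih _ (fun e' he' => ?_) (SlimVanish.insert he fun H hH hconn => ?_)
      · rw [map_sub, sub_eq_zero]
        rcases Finset.mem_insert.1 he' with rfl | he'
        · exact hDg.symm
        · rw [hf e' he', hgc e' he']
      · rw [map_sub, coeff_sub, hN H hH hconn, hgN H hH hconn, sub_zero]
    rw [← sub_add_cancel f g]
    exact Submodule.add_mem _ (cutSpan_insert_le hsub) hg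

end Core

/-! ### Exponentials and logarithms of nilpotent elements. -/

section Exponential

variable {A : Type*} [CommRing A] [Module ℚ A]

theorem exists_exp_eq {x : A} (hx : IsNilpotent x) :
    ∃ w, IsNilpotent.exp x = 1 + x + x ^ 2 * w := by
  obtain ⟨k, hk⟩ := hx
  refine ⟨∑ i ∈ Finset.range k, ((i + 2).factorial : ℚ)⁻¹ • x ^ i, ?_⟩
  rw [IsNilpotent.exp_eq_sum (k := k + 2) (by rw [pow_add, hk, zero_mul]),
    Finset.sum_range_succ', Finset.sum_range_succ', Finset.mul_sum]
  have : ∀ i, x ^ 2 * (((i + 2).factorial : ℚ)⁻¹ • x ^ i) =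
      ((i + 1 + 1).factorial : ℚ)⁻¹ • x ^ (i + 1 + 1) := fun i => by
    rw [mul_smul_comm, ← pow_add, add_comm 2 i]
  simp only [this]
  simp
  ring

theorem exists_exp_sub_one_eq {x : A} (hx : IsNilpotent x) :
    ∃ v, IsUnit v ∧ IsNilpotent.exp x - 1 = x * v := by
  obtain ⟨w, hw⟩ := exists_exp_eq hx
  refine ⟨1 + x * w, ((Commute.all x w).isNilpotent_mul_right hx).isUnit_one_add, ?_⟩
  rw [hw]; ring

/-- The exponential maps the nilpotent elements onto the unipotent elements. -/
theorem exists_exp_eq_one_add {z : A} (hz : IsNilpotent z) :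
    ∃ x, IsNilpotent x ∧ IsNilpotent.exp x = 1 + z := by
  have hnil (a : A) : IsNilpotent (z * a) := (Commute.all z a).isNilpotent_mul_right hz
  have key (k : ℕ) : ∃ a w, IsNilpotent.exp (z * a) = 1 + z + z ^ (k + 1) * w := by
    induction k with
    | zero => exact ⟨0, -1, by simp [IsNilpotent.exp_zero]⟩
    | succ k ih =>
      obtain ⟨a, w, h⟩ := ih
      obtain ⟨w', h'⟩ := exists_exp_eq (hnil (-(z ^ k * w)))
      -- Multiplying by `exp (-(z ^ (k + 1) * w))` cancels the error term to leading order in `z`.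
      refine ⟨a - z ^ k * w,
        -w + z ^ k * (-w ^ 2 + (1 + z + z ^ (k + 1) * w) * w ^ 2 * w'), ?_⟩
      rw [show z * (a - z ^ k * w) = z * a + z * -(z ^ k * w) by ring,
        IsNilpotent.exp_add_of_commute (Commute.all _ _) (hnil _) (hnil _), h, h']
      ring
  obtain ⟨k, hk⟩ := hz
  obtain ⟨a, w, h⟩ := key k
  refine ⟨z * a, hnil a, ?_⟩
  rw [h, pow_succ, hk]
  ring

theorem isNilpotent_sum_and_exp_sum {ι : Type*} {x : ι → A} (hx : ∀ i, IsNilpotent (x i))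
    (I : Finset ι) : IsNilpotent (∑ i ∈ I, x i) ∧
      IsNilpotent.exp (∑ i ∈ I, x i) = ∏ i ∈ I, IsNilpotent.exp (x i) := by
  classical
  induction I using Finset.induction_on with
  | empty => simp [IsNilpotent.exp_zero]
  | insert i I hi ih =>
    rw [Finset.sum_insert hi, Finset.prod_insert hi]
    refine ⟨(Commute.all _ _).isNilpotent_add (hx i) ih.1, ?_⟩
    rw [IsNilpotent.exp_add_of_commute (Commute.all _ _) (hx i) ih.1, ih.2]

theorem exp_sub_one_pow_eq_zero_iff {x : A} (hx : IsNilpotent x) (m : ℕ) :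
    (IsNilpotent.exp x - 1) ^ m = 0 ↔ x ^ m = 0 := by
  obtain ⟨v, hv, h⟩ := exists_exp_sub_one_eq hx
  rw [h, mul_pow, (hv.pow m).mul_left_eq_zero]

end Exponential

/-! ### Powers of sums of square-zero elements. -/

section SquareZero

variable {A : Type*} [CommRing A]

theorem add_pow_succ_of_sq_eq_zero {a : A} (ha : a ^ 2 = 0) (b : A) (m : ℕ) :
    (a + b) ^ (m + 1) = b ^ (m + 1) + (m + 1) * a * b ^ m := by
  induction m with
  | zero => simp [add_comm]
  | succ m ih =>
    rw [pow_succ, ih]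
    push_cast
    linear_combination ((m : A) + 1) * b ^ m * ha

theorem sum_pow_card_of_sq_eq_zero {ι : Type*} {a : ι → A} (ha : ∀ i, a i ^ 2 = 0)
    (S : Finset ι) : (∑ i ∈ S, a i) ^ S.card = S.card.factorial * ∏ i ∈ S, a i ∧
      (∑ i ∈ S, a i) ^ (S.card + 1) = 0 := by
  classical
  induction S using Finset.induction_on with
  | empty => simp
  | insert i S hi ih =>
    rw [Finset.card_insert_of_notMem hi, Finset.sum_insert hi, Finset.prod_insert hi,
      add_pow_succ_of_sq_eq_zero (ha i), add_pow_succ_of_sq_eq_zero (ha i), ih.2, ih.1,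
      pow_succ, ih.2, Nat.factorial_succ]
    refine ⟨?_, ?_⟩ <;> push_cast <;> ring

end SquareZero

/-! ### Orientation, cuts and connectivity of the multigraph. -/

section Graph

variable {n : ℕ} {β : Type*} (G : Graph (Fin (n + 1)) β) [G.Loopless]

theorem exists_isLink_lt (e : E(G)) : ∃ p : Fin (n + 1) × Fin (n + 1),
    G.IsLink e p.1 p.2 ∧ p.1 < p.2 := by
  obtain ⟨x, y, h⟩ := G.exists_isLink_of_mem_edgeSet e.2
  rcases lt_or_gt_of_ne h.ne with hlt | hlt
  · exact ⟨(x, y), h, hlt⟩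
  · exact ⟨(y, x), h.symm, hlt⟩

/-- The smaller end of an edge. -/
def src (e : E(G)) : Fin (n + 1) := (exists_isLink_lt G e).choose.1

/-- The larger end of an edge. -/
def tgt (e : E(G)) : Fin (n + 1) := (exists_isLink_lt G e).choose.2

theorem isLink_src_tgt (e : E(G)) : G.IsLink e (src G e) (tgt G e) :=
  (exists_isLink_lt G e).choose_spec.1

theorem src_lt_tgt (e : E(G)) : src G e < tgt G e :=
  (exists_isLink_lt G e).choose_spec.2

theorem isLink_iff (e : E(G)) (i j : Fin (n + 1)) :
    G.IsLink e i j ↔ (src G e = i ∧ tgt G e = j) ∨ (src G e = j ∧ tgt G e = i) :=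
  (isLink_src_tgt G e).isLink_iff

theorem coeff_eq_incidence (K : Type*) [Field K] (i : Fin (n + 1)) (e : E(G)) :
    coeff K G i e = incidence K (src G) (tgt G) i e := by
  have hlt := src_lt_tgt G e
  simp only [coeff, incidence, isLink_iff]
  by_cases h1 : src G e = i
  · subst h1
    rw [if_pos ⟨_, Or.inl ⟨rfl, rfl⟩, hlt⟩, if_pos rfl, if_neg hlt.ne', sub_zero]
  · by_cases h2 : tgt G e = i
    · subst h2
      rw [if_neg, if_pos ⟨_, Or.inr ⟨rfl, rfl⟩, hlt⟩, if_neg h1, if_pos rfl, zero_sub]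
      rintro ⟨j, ⟨h, -⟩ | ⟨rfl, -⟩, hj⟩
      · exact h1 h
      · exact absurd hlt hj.not_gt
    · simp [h1, h2]

theorem crosses_iff (I : Finset (Fin (n + 1))) (e : E(G)) :
    Crosses (src G) (tgt G) I e ↔ ∃ i ∈ I, ∃ j ∉ I, G.IsLink e i j := by
  simp only [isLink_iff, Crosses]
  constructor
  · intro h
    by_cases h1 : src G e ∈ I
    · exact ⟨_, h1, _, fun h2 => h (iff_of_true h1 h2), Or.inl ⟨rfl, rfl⟩⟩
    · exact ⟨_, by_contra fun h2 => h (iff_of_false h1 h2), _, h1, Or.inr ⟨rfl, rfl⟩⟩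
  · rintro ⟨i, hi, j, hj, ⟨rfl, rfl⟩ | ⟨rfl, rfl⟩⟩ <;> tauto

theorem cutSize_eq_card [Fintype E(G)] (I : Finset (Fin (n + 1))) :
    cutSize G I = (Finset.univ.filter (Crosses (src G) (tgt G) I)).card := by
  rw [cutSize, ← Set.ncard_coe_finset, ← Set.ncard_image_of_injective _ Subtype.val_injective]
  congr 1
  ext e
  simp only [Set.mem_ofPred_eq, Set.mem_image, Finset.coe_filter, Finset.mem_univ, true_and,
    crosses_iff]
  constructor
  · rintro ⟨i, hi, j, hj, h⟩
    exact ⟨⟨e, h.edge_mem⟩, ⟨i, hi, j, hj, h⟩, rfl⟩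
  · rintro ⟨e, h, rfl⟩
    exact h

theorem connected_iff_forall_exists_adj {W : Type*} [Nonempty W] (S : SimpleGraph W) :
    S.Connected ↔ ∀ I : Set W, I.Nonempty → I ≠ Set.univ → ∃ u ∈ I, ∃ v ∉ I, S.Adj u v := by
  constructor
  · rintro h I ⟨u, hu⟩ hI
    obtain ⟨v, hv⟩ := (Set.ne_univ_iff_exists_notMem I).1 hI
    obtain ⟨p⟩ := h.preconnected u v
    obtain ⟨d, -, h1, h2⟩ := p.exists_boundary_dart I hu hv
    exact ⟨_, h1, _, h2, d.adj⟩
  · intro h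
    refine ⟨fun u v => ?_⟩
    by_contra huv
    -- The component of `u` is a proper cut that no edge leaves.
    obtain ⟨a, ha, b, hb, hab⟩ := h {w | S.Reachable u w} ⟨u, SimpleGraph.Reachable.refl u⟩
      fun heq => huv (by have : v ∈ {w | S.Reachable u w} := heq ▸ Set.mem_univ v; exact this)
    exact hb (SimpleGraph.Reachable.trans ha hab.reachable)

variable {G}

open Classical in
theorem isSlim_iff_connects (hV : V(G) = Set.univ) [Fintype E(G)] (H : Finset E(G)) :
    IsSlim G H ↔ Connects (src G) (tgt G) (Finset.univ \ H) := by
  have hmem (i : Fin (n + 1)) :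
      i ∈ V(G.deleteEdges (Subtype.val '' (H : Set E(G)))) := by simp [hV]
  have : Nonempty V(G.deleteEdges (Subtype.val '' (H : Set E(G)))) := ⟨⟨0, hmem 0⟩⟩
  have hadj (e : E(G)) (i j : Fin (n + 1)) (he : e ∉ H) (h : G.IsLink e i j) :
      (G.deleteEdges (Subtype.val '' (H : Set E(G)))).toSimpleGraph.Adj
        ⟨i, hmem i⟩ ⟨j, hmem j⟩ := by
    refine ⟨fun hij => h.ne (congrArg Subtype.val hij), e, ?_⟩
    simp [h, he]
  rw [IsSlim, connected_iff_forall_exists_adj]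
  constructor
  · rintro h I ⟨i, hi⟩ hI
    obtain ⟨u, hu, v, hv, -, e, he⟩ := h {w | w.1 ∈ I} ⟨⟨i, hmem i⟩, hi⟩ fun heq => hI <| by
      ext j
      simpa using (Set.ext_iff.1 heq) ⟨j, hmem j⟩
    rw [Graph.deleteEdges_isLink] at he
    refine ⟨⟨e, he.1.edge_mem⟩, ?_, (crosses_iff G I _).2 ⟨u, hu, v, hv, he.1⟩⟩
    simpa [he.1.edge_mem] using he.2
  · rintro h I ⟨u, hu⟩ hI
    obtain ⟨v, hv⟩ := (Set.ne_univ_iff_exists_notMem I).1 hI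
    obtain ⟨e, he, hc⟩ := h (Finset.univ.filter fun i => (⟨i, hmem i⟩ : Subtype _) ∈ I)
      ⟨u.1, by simpa using hu⟩ fun heq => hv <| by
        have := Finset.mem_univ v.1
        rw [← heq] at this
        simpa using this
    obtain ⟨i, hi, j, hj, hij⟩ := (crosses_iff G _ e).1 hc
    exact ⟨_, by simpa using hi, _, by simpa using hj, hadj e i j (by simpa using he) hij⟩

end Graph

/-! ### The relations among the `X_i` and the `Y_i`. -/

section Presentation

variable {K : Type*} [Field K] {n : ℕ} {β : Type*} {G : Graph (Fin (n + 1)) β}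
  [G.Loopless] [Fintype E(G)]

theorem aeval_xT_eq_mk_toEdges (f : MvPolynomial (Fin (n + 1)) K) :
    aeval (xT K G) f = Ideal.Quotient.mk (phiIdeal K G) (toEdges K (src G) (tgt G) f) := by
  have h : aeval (xT K G) =
      (Ideal.Quotient.mkₐ K (phiIdeal K G)).comp (toEdges K (src G) (tgt G)) := by
    ext1 i
    simp only [aeval_X, xT, toEdges, AlgHom.comp_apply, map_sum, map_smul, coeff_eq_incidence]
    rfl
  rw [h]
  rfl

open Classical in
-- The ideal is monomial, and no generator divides the monomial of a slim set: that monomial is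
-- squarefree, and subsets of slim sets are slim.
theorem coeff_indicatorExp_eq_zero_of_mem_phiIdeal (hV : V(G) = Set.univ) {H : Finset E(G)}
    (hH : Connects (src G) (tgt G) (Finset.univ \ H)) {p : MvPolynomial E(G) K}
    (hp : p ∈ phiIdeal K G) : MvPolynomial.coeff (indicatorExp H) p = 0 := by
  suffices h : ∀ q, MvPolynomial.coeff (indicatorExp H) (q * p) = 0 by simpa using h 1
  refine Submodule.span_induction ?_ (fun q => by simp)
    (fun p q _ _ hp hq r => by rw [mul_add, coeff_add, hp, hq, add_zero]) ?_
    (p := fun p _ => ∀ q, MvPolynomial.coeff (indicatorExp H) (q * p) = 0) hp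
  · rintro _ (⟨e, rfl⟩ | ⟨H', hH', rfl⟩) q
    · rw [X_pow_eq_monomial, coeff_mul_monomial', if_neg]
      intro hle
      have := hle e
      rw [indicatorExp_apply] at this
      simp at this
      split_ifs at this <;> omega
    · have hmon : ∏ e ∈ H', (X e : MvPolynomial E(G) K) = monomial (indicatorExp H') 1 := by
        rw [indicatorExp, monomial_sum_one]
        rfl
      rw [hmon, coeff_mul_monomial', if_neg]
      intro hle
      have hsub : H' ⊆ H := fun e he => by
        have := hle e
        rw [indicatorExp_apply, indicatorExp_apply, if_pos he] at this
        by_contra h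
        simp [h] at this
      refine hH' ((isSlim_iff_connects hV H').2 fun I h1 h2 => ?_)
      obtain ⟨e, he, hc⟩ := hH I h1 h2
      exact ⟨e, Finset.sdiff_subset_sdiff le_rfl hsub he, hc⟩
  · intro a p _ hp q
    rw [smul_eq_mul, ← mul_assoc]
    exact hp _

open Classical in
theorem mem_cutSpan_of_aeval_xT_eq_zero [CharZero K] (hV : V(G) = Set.univ)
    {f : MvPolynomial (Fin (n + 1)) K} (hf : aeval (xT K G) f = 0) :
    f ∈ cutSpan K (src G) (tgt G) ∅ Finset.univ := by
  rw [aeval_xT_eq_mk_toEdges, Ideal.Quotient.eq_zero_iff_mem] at hf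
  refine mem_cutSpan_of_slimVanish _ _ (fun e he => absurd he (Finset.notMem_empty e)) ?_
  intro H _ hconn
  rw [Finset.union_empty] at hconn
  exact coeff_indicatorExp_eq_zero_of_mem_phiIdeal hV hconn hf

open Classical in
-- The two signs of an edge with both ends in `I` cancel, so only crossing edges remain.
theorem sum_xT (I : Finset (Fin (n + 1))) :
    ∃ c : E(G) → K, ∑ i ∈ I, xT K G i =
      ∑ e ∈ Finset.univ.filter (Crosses (src G) (tgt G) I), c e • phi K G e := by
  refine ⟨fun e => ∑ i ∈ I, coeff K G i e, ?_⟩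
  simp only [xT]
  rw [Finset.sum_comm, Finset.sum_filter]
  refine Finset.sum_congr rfl fun e _ => ?_
  rw [← Finset.sum_smul]
  split_ifs with h
  · rfl
  · have : ∑ i ∈ I, coeff K G i e = 0 := by
      simp only [coeff_eq_incidence, incidence, Finset.sum_sub_distrib, Finset.sum_ite_eq]
      unfold Crosses at h
      by_cases h1 : src G e ∈ I <;> by_cases h2 : tgt G e ∈ I <;> simp_all
    rw [this, zero_smul]

/-- The power is a scalar multiple of the product of all edges crossing `I`, and deleting these
disconnects the graph. -/
theorem sum_xT_pow_cutSize (hV : V(G) = Set.univ) {I : Finset (Fin (n + 1))} (h1 : I.Nonempty)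
    (h2 : I ≠ Finset.univ) : (∑ i ∈ I, xT K G i) ^ cutSize G I = 0 := by
  classical
  obtain ⟨c, hc⟩ := sum_xT (K := K) (G := G) I
  rw [hc, cutSize_eq_card, (sum_pow_card_of_sq_eq_zero (fun e => by
    rw [smul_pow, phi_sq, smul_zero]) _).1, Finset.prod_smul]
  have : ∏ e ∈ Finset.univ.filter (Crosses (src G) (tgt G) I), phi K G e = 0 := by
    simp only [phi]
    rw [← map_prod, Ideal.Quotient.eq_zero_iff_mem]
    refine Ideal.subset_span (Or.inr ⟨_, fun hs => ?_, rfl⟩)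
    obtain ⟨e, he, hce⟩ := (isSlim_iff_connects hV _).1 hs I h1 h2
    simp [hce] at he
  rw [this, smul_zero, mul_zero]

theorem sum_xT_univ : ∑ i, xT K G i = 0 := by
  classical
  obtain ⟨c, hc⟩ := sum_xT (K := K) (G := G) Finset.univ
  rw [hc, Finset.filter_false_of_mem fun e _ => by simp [Crosses], Finset.sum_empty]

theorem idealD_le_ker_aeval_yT [CharZero K] (hV : V(G) = Set.univ) :
    idealD K G ≤ RingHom.ker (aeval (yT K G)) := by
  have hx (i) := (exp_xT K G i).1
  refine Ideal.span_le.2 (Set.union_subset ?_ ?_)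
  · rintro _ ⟨I, h1, h2, rfl⟩
    obtain ⟨hn, he⟩ := isNilpotent_sum_and_exp_sum hx I
    simp only [SetLike.mem_coe, RingHom.mem_ker, map_pow, map_sub, map_prod, aeval_X, map_one]
    simp only [← (exp_xT K G _).2]
    rw [← he, exp_sub_one_pow_eq_zero_iff hn, sum_xT_pow_cutSize hV h1 h2]
  · rintro _ rfl
    simp only [SetLike.mem_coe, RingHom.mem_ker, map_sub, map_prod, aeval_X, map_one]
    simp only [← (exp_xT K G _).2]
    rw [← (isNilpotent_sum_and_exp_sum hx _).2, sum_xT_univ, IsNilpotent.exp_zero, sub_self]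

theorem prod_genD_sub_one_pow {I : Finset (Fin (n + 1))} (h1 : I.Nonempty)
    (h2 : I ≠ Finset.univ) : (∏ i ∈ I, genD K G i - 1) ^ cutSize G I = 0 := by
  simp only [genD]
  rw [← map_prod, ← map_one (Ideal.Quotient.mk _), ← map_sub, ← map_pow,
    Ideal.Quotient.eq_zero_iff_mem]
  exact Ideal.subset_span (Or.inl ⟨I, h1, h2, rfl⟩)

theorem prod_genD_univ : ∏ i, genD K G i = 1 := by
  simp only [genD]
  rw [← map_prod, ← sub_eq_zero, ← map_one (Ideal.Quotient.mk _), ← map_sub,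
    Ideal.Quotient.eq_zero_iff_mem]
  exact Ideal.subset_span (Or.inr rfl)

theorem isNilpotent_genD_sub_one (i : Fin (n + 1)) : IsNilpotent (genD K G i - 1) := by
  by_cases h : ({i} : Finset (Fin (n + 1))) = Finset.univ
  -- With a single vertex there is no proper cut, but the product relation says `y_i = 1`.
  · have := prod_genD_univ (K := K) (G := G)
    rw [← h, Finset.prod_singleton] at this
    simp [this]
  · exact ⟨_, by simpa using prod_genD_sub_one_pow (K := K) (Finset.singleton_nonempty i) h⟩

theorem aeval_eq_zero_of_mem_cutSpan [CharZero K] {x : Fin (n + 1) → AlgD K G}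
    (hx : ∀ i, IsNilpotent (x i)) (hexp : ∀ i, IsNilpotent.exp (x i) = genD K G i)
    [DecidableEq E(G)] {f : MvPolynomial (Fin (n + 1)) K}
    (hf : f ∈ cutSpan K (src G) (tgt G) ∅ Finset.univ) : aeval x f = 0 := by
  suffices h : cutSpan K (src G) (tgt G) ∅ Finset.univ ≤ LinearMap.ker (aeval x).toLinearMap from
    h hf
  refine Submodule.span_le.2 (Set.union_subset ?_ ?_)
  · rintro _ ⟨I, h1, h2, -, h, -, rfl⟩
    obtain ⟨hn, he⟩ := isNilpotent_sum_and_exp_sum hx I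
    have : (∑ i ∈ I, x i) ^ cutSize G I = 0 := by
      rw [← exp_sub_one_pow_eq_zero_iff hn, he]
      simp only [hexp]
      exact prod_genD_sub_one_pow h1 h2
    simp [vertexSum, ← cutSize_eq_card, this]
  · rintro _ ⟨h, -, rfl⟩
    obtain ⟨hn, he⟩ := isNilpotent_sum_and_exp_sum hx Finset.univ
    have : (∑ i, x i) ^ 1 = 0 := by
      rw [← exp_sub_one_pow_eq_zero_iff hn, he]
      simp only [hexp]
      simp [prod_genD_univ]
    rw [pow_one] at this
    simp [vertexSum, this]

theorem ker_aeval_yT [CharZero K] (hV : V(G) = Set.univ) :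
    RingHom.ker (aeval (yT K G) : MvPolynomial (Fin (n + 1)) K →ₐ[K] PhiT K G) = idealD K G := by
  classical
  refine le_antisymm (fun f hf => ?_) (idealD_le_ker_aeval_yT hV)
  rw [RingHom.mem_ker] at hf
  choose x hx hexp using fun i => exists_exp_eq_one_add (isNilpotent_genD_sub_one (K := K)
    (G := G) i)
  simp only [add_sub_cancel] at hexp
  choose a ha using hx
  choose b hb using fun i => (exp_xT K G i).1
  -- One truncation order that serves all the nilpotent elements in both algebras.
  let N := ∑ i, (a i + b i)
  have hN (i) : a i + b i ≤ N :=
    Finset.single_le_sum (f := fun i => a i + b i) (fun _ _ => Nat.zero_le _) (Finset.mem_univ i)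
  let P (i : Fin (n + 1)) : MvPolynomial (Fin (n + 1)) K :=
    ∑ k ∈ Finset.range N, (k.factorial : ℚ)⁻¹ • X i ^ k
  have hPx (i) : aeval x (P i) = genD K G i := by
    rw [← hexp, IsNilpotent.exp_eq_sum (k := N)
      (pow_eq_zero_of_le ((Nat.le_add_right _ _).trans (hN i)) (ha i))]
    simp [P, map_rat_smul]
  have hPX (i) : aeval (xT K G) (P i) = yT K G i := by
    rw [← (exp_xT K G i).2, IsNilpotent.exp_eq_sum (k := N)
      (pow_eq_zero_of_le ((Nat.le_add_left _ _).trans (hN i)) (hb i))]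
    simp [P, map_rat_smul]
  -- Substituting truncated exponentials into `f` gives a relation among the `X_i`; evaluated at the
  -- logarithms of the `y_i`, it becomes the class of `f` in `AlgD`.
  have h1 : aeval (xT K G) (aeval P f) = 0 := by
    rw [← AlgHom.comp_apply, comp_aeval]
    simpa only [hPX] using hf
  have h2 := aeval_eq_zero_of_mem_cutSpan (fun i => ⟨_, ha i⟩) hexp
    (mem_cutSpan_of_aeval_xT_eq_zero hV h1)
  rw [← AlgHom.comp_apply, comp_aeval] at h2
  simp only [hPx] at h2
  have h3 : (aeval (genD K G) : MvPolynomial (Fin (n + 1)) K →ₐ[K] AlgD K G) =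
      Ideal.Quotient.mkₐ K (idealD K G) := by
    ext i
    simp [genD]
  rw [h3] at h2
  exact Ideal.Quotient.eq_zero_iff_mem.1 h2

theorem algK_val_comp_aeval_genK :
    (algK K G).val.comp (aeval (genK K G)) = aeval (yT K G) := by
  ext i
  simp [genK]

theorem aeval_genK_surjective : Function.Surjective
    (aeval (genK K G) : MvPolynomial (Fin (n + 1)) K →ₐ[K] algK K G) := by
  rintro ⟨y, hy⟩
  have hy' := hy
  rw [algK, Algebra.adjoin_range_eq_range_aeval] at hy'
  obtain ⟨f, hf⟩ := hy'
  refine ⟨f, Subtype.ext ?_⟩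
  refine Eq.trans ?_ hf
  exact DFunLike.congr_fun algK_val_comp_aeval_genK f

theorem ker_aeval_genK [CharZero K] (hV : V(G) = Set.univ) :
    RingHom.ker (aeval (genK K G) : MvPolynomial (Fin (n + 1)) K →ₐ[K] algK K G) =
      idealD K G := by
  rw [← ker_aeval_yT hV, ← algK_val_comp_aeval_genK]
  ext f
  simp [RingHom.mem_ker]

end Presentation

end SpanningTreeAlgebra

end

/-! ### The filtered isomorphism. -/

theorem mainTheorem6 (K : Type*) [Field K] [CharZero K] {n : ℕ} {β : Type*}
    (G : Graph (Fin (n + 1)) β) (hV : V(G) = Set.univ) [G.Loopless] [Fintype E(G)] :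
    ∃ h : SpanningTreeAlgebra.AlgD K G ≃ₐ[K] SpanningTreeAlgebra.algK K G,
      ∀ k : ℕ,
        (SpanningTreeAlgebra.filtration K (SpanningTreeAlgebra.genD K G) k).map
            (h : SpanningTreeAlgebra.AlgD K G →ₗ[K] SpanningTreeAlgebra.algK K G) =
          SpanningTreeAlgebra.filtration K (SpanningTreeAlgebra.genK K G) k := by
  let h : SpanningTreeAlgebra.AlgD K G ≃ₐ[K] SpanningTreeAlgebra.algK K G :=
    (Ideal.quotientEquivAlgOfEq K (SpanningTreeAlgebra.ker_aeval_genK hV).symm).trans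
      (Ideal.quotientKerAlgEquivOfSurjective SpanningTreeAlgebra.aeval_genK_surjective)
  have hgen (i : Fin (n + 1)) :
      h (SpanningTreeAlgebra.genD K G i) = SpanningTreeAlgebra.genK K G i :=
    aeval_X _ i
  -- Since generators go to generators, `h` commutes with evaluation of polynomials, so the
  -- filtrations correspond degree by degree.
  have hcomp : (h : SpanningTreeAlgebra.AlgD K G →ₐ[K] SpanningTreeAlgebra.algK K G).comp
      (aeval (SpanningTreeAlgebra.genD K G)) = aeval (SpanningTreeAlgebra.genK K G) := by
    ext1 i
    simp [hgen]
  refine ⟨h, fun k => ?_⟩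
  rw [SpanningTreeAlgebra.filtration, SpanningTreeAlgebra.filtration, ← Submodule.map_comp,
    ← hcomp]
  rfl
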